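/- Proposition (affine forms via isotropic parallelograms). Let $\mathcal{G}\rightrightarrows M$ be a Lie groupoid over finite-dimensional smooth real manifolds without boundary, with source and target maps $s,t:\mathcal{G}\to M$ (smooth submersions), unit map $\iota:M\to\mathcal{G}$, and multiplication $m:\mathcal{G}^{(2)}\to\mathcal{G}$, $m(g,h)=gh$, on the manifold $\mathcal{G}^{(2)}=\{(g,h)\in\mathcal{G}\times\mathcal{G}: s(g)=t(h)\}$ of composable pairs. Let $k\ge 0$ and let $\Theta\in\Omega^k(\mathcal{G})$ be a smooth $k$-form. Put $\theta:=\iota^*\Theta\in\Omega^k(M)$. The form $\Theta$ is called affine if $$m^*\Theta=\mathrm{pr}_1^*\Theta+\mathrm{pr}_2^*\Theta-\mathrm{pr}_1^*s^*\theta\quad\text{on }\mathcal{G}^{(2)},$$ where $\mathrm{pr}_1,\mathrm{pr}_2:\mathcal{G}^{(2)}\to\mathcal{G}$ are the two projections. Then $\Theta$ is affine if and only if the set of parallelograms $$\Gamma=\{(g,h,l,hg^{-1}l): g,h,l\in\mathcal{G},\ s(g)=s(h),\ t(g)=t(l)\}\subset\mathcal{G}\times\mathcal{G}\times\mathcal{G}\times\mathcal{G}$$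 is an isotropic submanifold of $\mathcal{G}\times\mathcal{G}\times\mathcal{G}\times\mathcal{G}$ with respect to $\Theta\oplus-\Theta\oplus-\Theta\oplus\Theta$, that is, $\Gamma$ is an (embedded) submanifold and $$i^*\big(\mathrm{pr}_1^*\Theta-\mathrm{pr}_2^*\Theta-\mathrm{pr}_3^*\Theta+\mathrm{pr}_4^*\Theta\big)=0,$$ where $\mathrm{pr}_1,\dots,\mathrm{pr}_4$ are the projections $\mathcal{G}^4\to\mathcal{G}$ and $i:\Gamma\hookrightarrow\mathcal{G}^4$ is the inclusion. -/

import Mathlib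

open scoped Manifold ContDiff

noncomputable section

section Forms

variable {E : Type*} [NormedAddCommGroup E] [NormedSpace ℝ E]
  {H : Type*} [TopologicalSpace H] (I : ModelWithCorners ℝ E H)
  (N : Type*) [TopologicalSpace N] [ChartedSpace H N]
  {E' : Type*} [NormedAddCommGroup E'] [NormedSpace ℝ E']
  {H' : Type*} [TopologicalSpace H'] (I' : ModelWithCorners ℝ E' H')
  {N' : Type*} [TopologicalSpace N'] [ChartedSpace H' N']

/-- A (not necessarily smooth) field of alternating `k`-linear forms on the tangent spaces of the
manifold `N`.  A differential `k`-form is such a field that satisfies `IsSmoothForm`. -/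
abbrev FormField (k : ℕ) : Type _ :=
  ∀ x : N, (TangentSpace I x) [⋀^Fin k]→L[ℝ] ℝ

variable {N} {k : ℕ}

/-- The coordinate expression, on the model space `E`, of a field of `k`-forms in the preferred
chart at `x₀`: its pullback under the inverse of the chart. -/
def FormField.inChart (α : FormField I N k) (x₀ : N) (e : E) : E [⋀^Fin k]→L[ℝ] ℝ :=
  (α ((extChartAt I x₀).symm e)).compContinuousLinearMap
    (mfderivWithin 𝓘(ℝ, E) I (extChartAt I x₀).symm (Set.range I) e)

/-- A field of `k`-forms is smooth (so it is a differential `k`-form) if its expressions in charts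
are smooth. -/
def IsSmoothForm (α : FormField I N k) : Prop :=
  ∀ x₀ : N, ContDiffOn ℝ ∞ (α.inChart I x₀) (extChartAt I x₀).target

variable {I I'}

/-- The pullback `f^* α` of a field of `k`-forms under a map `f : N → N'`. -/
def FormField.pullback (f : N → N') (α : FormField I' N' k) : FormField I N k :=
  fun x => (α (f x)).compContinuousLinearMap (mfderiv I I' f x)

/-- The pullback under a map `f` that is defined (and smooth) only on a submanifold `S ⊆ N`.  Only
the values at points of `S` on vectors that are tangent to `S` are meaningful: on these,
`mfderivWithin I I' f S` is the differential of `f : S → N'`. -/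
def FormField.pullbackOn (S : Set N) (f : N → N') (α : FormField I' N' k) : FormField I N k :=
  fun x => (α (f x)).compContinuousLinearMap (mfderivWithin I I' f S x)

variable (I)

/-- The vectors at `x` that are tangent to the submanifold `S ⊆ N`: the velocities at time `0` of
the smooth curves in `S` that pass through `x` at time `0`. -/
def tangentVectorsTo (S : Set N) (x : N) : Set (TangentSpace I x) :=
  {v | ∃ ε > (0 : ℝ), ∃ γ : ℝ → N,
    ContMDiffOn 𝓘(ℝ, ℝ) I ∞ γ (Set.Ioo (-ε) ε) ∧ (∀ τ ∈ Set.Ioo (-ε) ε, γ τ ∈ S) ∧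
    tangentMap 𝓘(ℝ, ℝ) I γ ⟨0, (1 : ℝ)⟩ = ⟨x, v⟩}

/-- `S ⊆ N` is an (embedded) smooth submanifold of dimension `d`: near each of its points there is
a chart of `N` in which `S` is a (translated) linear subspace of dimension `d`. -/
def IsSubmanifold (S : Set N) (d : ℕ) : Prop :=
  ∀ x ∈ S, ∃ φ ∈ IsManifold.maximalAtlas I ∞ N, x ∈ φ.source ∧
    ∃ W : Submodule ℝ E, Module.finrank ℝ W = d ∧
      ∀ y ∈ φ.source, y ∈ S ↔ φ.extend I y - φ.extend I x ∈ W

variable {I}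

/-- The fields of `k`-forms `α` and `β` have the same restriction to the submanifold `S`, i.e.
`i^* α = i^* β` for the inclusion `i : S → N`. -/
def FormField.EqOnSubmanifold (α β : FormField I N k) (S : Set N) : Prop :=
  ∀ x ∈ S, ∀ v : Fin k → TangentSpace I x, (∀ i, v i ∈ tangentVectorsTo I S x) → α x v = β x v

/-- `S` is an isotropic submanifold of `N` with respect to `α`: it is a submanifold, and the
restriction `i^* α` of `α` to it vanishes. -/
def IsIsotropicSubmanifold (S : Set N) (α : FormField I N k) : Prop :=
  (∃ d : ℕ, IsSubmanifold I S d) ∧ α.EqOnSubmanifold (fun _ => 0) S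

end Forms

/-- A Lie groupoid `G ⇉ M`, over manifolds `G` and `M` without boundary that are modelled on `E`
and `F`.  Arrows `g` and `h` are composable iff `src g = tgt h`; the values `mul g h` for pairs
that are not composable play no role. -/
structure LieGroupoid (E : Type*) [NormedAddCommGroup E] [NormedSpace ℝ E]
    (F : Type*) [NormedAddCommGroup F] [NormedSpace ℝ F]
    (G : Type*) [TopologicalSpace G] [ChartedSpace E G]
    (M : Type*) [TopologicalSpace M] [ChartedSpace F M] where
  /-- the source map -/
  src : G → M
  /-- the target map -/
  tgt : G → M
  /-- the identity arrows -/
  unit : M → G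
  /-- the inverse map -/
  inv : G → G
  /-- the multiplication of composable arrows -/
  mul : G → G → G
  src_unit : ∀ x, src (unit x) = x
  tgt_unit : ∀ x, tgt (unit x) = x
  src_inv : ∀ g, src (inv g) = tgt g
  tgt_inv : ∀ g, tgt (inv g) = src g
  src_mul : ∀ g h, src g = tgt h → src (mul g h) = src h
  tgt_mul : ∀ g h, src g = tgt h → tgt (mul g h) = tgt g
  mul_assoc : ∀ g h l, src g = tgt h → src h = tgt l → mul (mul g h) l = mul g (mul h l)
  unit_mul : ∀ g, mul (unit (tgt g)) g = g
  mul_unit : ∀ g, mul g (unit (src g)) = g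
  inv_mul : ∀ g, mul (inv g) g = unit (src g)
  mul_inv : ∀ g, mul g (inv g) = unit (tgt g)
  isSubmersion_src : Manifold.IsSubmersion 𝓘(ℝ, E) 𝓘(ℝ, F) ∞ src
  isSubmersion_tgt : Manifold.IsSubmersion 𝓘(ℝ, E) 𝓘(ℝ, F) ∞ tgt
  contMDiff_unit : ContMDiff 𝓘(ℝ, F) 𝓘(ℝ, E) ∞ unit
  contMDiff_inv : ContMDiff 𝓘(ℝ, E) 𝓘(ℝ, E) ∞ inv
  /-- The multiplication is smooth on the submanifold of composable pairs. -/
  contMDiffOn_mul : ContMDiffOn (𝓘(ℝ, E).prod 𝓘(ℝ, E)) 𝓘(ℝ, E) ∞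
    (fun p : G × G => mul p.1 p.2) {p : G × G | src p.1 = tgt p.2}

namespace LieGroupoid

variable {E : Type*} [NormedAddCommGroup E] [NormedSpace ℝ E]
  {F : Type*} [NormedAddCommGroup F] [NormedSpace ℝ F]
  {G : Type*} [TopologicalSpace G] [ChartedSpace E G]
  {M : Type*} [TopologicalSpace M] [ChartedSpace F M] {k : ℕ}

/-- The set `G⁽²⁾` of composable pairs. -/
def composable (𝒢 : LieGroupoid E F G M) : Set (G × G) :=
  {p | 𝒢.src p.1 = 𝒢.tgt p.2}

/-- The set of parallelograms `(g, h, l, h g⁻¹ l)`, where `s(g) = s(h)` and `t(g) = t(l)`. -/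
def parallelograms (𝒢 : LieGroupoid E F G M) : Set (G × G × G × G) :=
  {p | ∃ g h l : G, 𝒢.src g = 𝒢.src h ∧ 𝒢.tgt g = 𝒢.tgt l ∧
    p = (g, h, l, 𝒢.mul (𝒢.mul h (𝒢.inv g)) l)}

/-- The component `θ = ι^* Θ` of `Θ|_M` along `M`, where `ι : M → G` is the unit map. -/
def baseForm (𝒢 : LieGroupoid E F G M) (Θ : FormField 𝓘(ℝ, E) G k) : FormField 𝓘(ℝ, F) M k :=
  Θ.pullback 𝒢.unit

/-- `Θ` is affine: `m^* Θ = pr₁^* Θ + pr₂^* Θ - pr₁^* s^* θ` on `G⁽²⁾`, where `θ = ι^* Θ`. -/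
def IsAffine (𝒢 : LieGroupoid E F G M) (Θ : FormField 𝓘(ℝ, E) G k) : Prop :=
  FormField.EqOnSubmanifold (I := 𝓘(ℝ, E).prod 𝓘(ℝ, E))
    (Θ.pullbackOn 𝒢.composable (fun p : G × G => 𝒢.mul p.1 p.2))
    (fun p => Θ.pullback (Prod.fst : G × G → G) p + Θ.pullback (Prod.snd : G × G → G) p
      - FormField.pullback (I' := 𝓘(ℝ, E)) (Prod.fst : G × G → G)
          ((𝒢.baseForm Θ).pullback 𝒢.src) p)
    𝒢.composable

end LieGroupoid

/-- The field of `k`-forms `Θ ⊕ -Θ ⊕ -Θ ⊕ Θ = pr₁^* Θ - pr₂^* Θ - pr₃^* Θ + pr₄^* Θ` on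
`G × G × G × G`. -/
def alternatingSum {E : Type*} [NormedAddCommGroup E] [NormedSpace ℝ E]
    {G : Type*} [TopologicalSpace G] [ChartedSpace E G] {k : ℕ} (Θ : FormField 𝓘(ℝ, E) G k) :
    FormField (𝓘(ℝ, E).prod (𝓘(ℝ, E).prod (𝓘(ℝ, E).prod 𝓘(ℝ, E)))) (G × G × G × G) k :=
  fun p => Θ.pullback (fun q : G × G × G × G => q.1) p
    - Θ.pullback (fun q : G × G × G × G => q.2.1) p
    - Θ.pullback (fun q : G × G × G × G => q.2.2.1) p
    + Θ.pullback (fun q : G × G × G × G => q.2.2.2) p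

end

/-!
The form `Θ` is evaluated on velocities of curves. For maps `f` into `G`, write `Θ(f)` for the
pullback `f^* Θ`, evaluated on velocities of curves in a submanifold that contains them and on which
`f` is smooth (`FormField.alongCurves`). It depends only on the restriction of `f` to the
submanifold, so identities between arrows turn into identities between values of `Θ`. In these terms
`Θ` is affine if `Θ(ab) = Θ(a) + Θ(b) - Θ(1_{s(a)})` for all pairs `(a, b)` of composable arrows
that depend smoothly on a parameter, and it vanishes on parallelograms if
`Θ(g) - Θ(h) - Θ(l) + Θ(h g⁻¹ l) = 0`.

If `Θ` is affine, then the products `g g⁻¹ = 1_{t(g)}`, `h g⁻¹` and `(h g⁻¹) l` give three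
equations, whose combination is the second identity
(`LieGroupoid.IsAffine.eqOnSubmanifold_parallelograms`). Conversely, the parallelogram
`(1_{s(a)}, a, b, ab)` gives the first
(`LieGroupoid.isAffine_of_eqOnSubmanifold_parallelograms`).

The parallelograms form a submanifold whatever `Θ` is (`LieGroupoid.isSubmanifold_parallelograms`):
in charts of `G` adapted to the submersions `s` near `h` and `t` near `l`, they are the graph of a
smooth map, and a shear turns the product chart of `G⁴` into a chart in which this graph is a linear
subspace (`exists_submanifold_chart_of_graph`). The multiplication is given only on composable
pairs, which the parameters of the graph satisfy identically, so no extension of it is needed.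
-/

open scoped Manifold ContDiff Topology
open Set Filter

noncomputable section

/-! ### Velocities of curves -/

section Velocity

variable {E : Type*} [NormedAddCommGroup E] [NormedSpace ℝ E]
  {H : Type*} [TopologicalSpace H] {I : ModelWithCorners ℝ E H}
  {N : Type*} [TopologicalSpace N] [ChartedSpace H N]
  {E' : Type*} [NormedAddCommGroup E'] [NormedSpace ℝ E']
  {H' : Type*} [TopologicalSpace H'] {I' : ModelWithCorners ℝ E' H'}
  {N' : Type*} [TopologicalSpace N'] [ChartedSpace H' N'] {k : ℕ}

variable (I) in
/-- The velocity at time `0` of a curve in `N`, as a tangent vector at `x`. It is meaningful if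
`c 0 = x`. All tangent spaces are copies of the model space `E`, so the base point can be given
independently of `c`; this lets curves through points that are only propositionally equal be
compared. -/
def velocity (x : N) (c : ℝ → N) : TangentSpace I x :=
  (mfderiv 𝓘(ℝ, ℝ) I c 0 (1 : ℝ) : TangentSpace I (c 0))

variable (I) in
/-- `c` is, for small times, a smooth curve in `S`, and it passes through `x` at time `0`. -/
def IsCurveIn (S : Set N) (x : N) (c : ℝ → N) : Prop :=
  c 0 = x ∧ ∃ ε > (0 : ℝ), ContMDiffOn 𝓘(ℝ, ℝ) I ∞ c (Ioo (-ε) ε) ∧ ∀ τ ∈ Ioo (-ε) ε, c τ ∈ S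

lemma mem_tangentVectorsTo_iff {S : Set N} {x : N} {v : TangentSpace I x} :
    v ∈ tangentVectorsTo I S x ↔ ∃ c : ℝ → N, IsCurveIn I S x c ∧ velocity I x c = v := by
  constructor
  · rintro ⟨ε, hε, c, hc, hS, h⟩
    obtain rfl : c 0 = x := congrArg Bundle.TotalSpace.proj h
    refine ⟨c, ⟨rfl, ε, hε, hc, hS⟩, ?_⟩
    simp only [tangentMap, Bundle.TotalSpace.mk.injEq, heq_eq_eq, true_and] at h
    exact h
  · rintro ⟨c, ⟨rfl, ε, hε, hc, hS⟩, rfl⟩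
    exact ⟨ε, hε, c, hc, hS, rfl⟩

lemma FormField.eqOnSubmanifold_iff {α β : FormField I N k} {S : Set N} :
    α.EqOnSubmanifold β S ↔ ∀ x ∈ S, ∀ c : Fin k → ℝ → N, (∀ i, IsCurveIn I S x (c i)) →
      α x (fun i => velocity I x (c i)) = β x (fun i => velocity I x (c i)) := by
  constructor
  · intro h x hx c hc
    exact h x hx _ fun i => mem_tangentVectorsTo_iff.2 ⟨c i, hc i, rfl⟩
  · intro h x hx v hv
    choose c hc hcv using fun i => mem_tangentVectorsTo_iff.1 (hv i)
    simpa only [hcv] using h x hx c hc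

lemma IsCurveIn.contMDiffAt {S : Set N} {x : N} {c : ℝ → N} (hc : IsCurveIn I S x c) :
    ContMDiffAt 𝓘(ℝ, ℝ) I ∞ c 0 := by
  obtain ⟨-, ε, hε, h, -⟩ := hc
  exact h.contMDiffAt (Ioo_mem_nhds (by linarith) hε)

lemma IsCurveIn.eventually_mem {S : Set N} {x : N} {c : ℝ → N} (hc : IsCurveIn I S x c) :
    ∀ᶠ τ in 𝓝 (0 : ℝ), c τ ∈ S := by
  obtain ⟨-, ε, hε, -, h⟩ := hc
  filter_upwards [Ioo_mem_nhds (by linarith : -ε < 0) hε] with τ hτ using h τ hτ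

lemma IsCurveIn.comp {S : Set N} {T : Set N'} {x : N} {c : ℝ → N} {f : N → N'}
    (hc : IsCurveIn I S x c) (hf : ContMDiffOn I I' ∞ f S) (hST : MapsTo f S T) :
    IsCurveIn I' T (f x) (fun τ => f (c τ)) := by
  obtain ⟨rfl, ε, hε, h, hS⟩ := hc
  exact ⟨rfl, ε, hε, hf.comp h hS, fun τ hτ => hST (hS τ hτ)⟩

lemma velocity_congr (x : N) {c c' : ℝ → N} (h : c =ᶠ[𝓝 0] c') :
    velocity I x c = velocity I x c' := by
  have : mfderiv 𝓘(ℝ, ℝ) I c 0 = mfderiv 𝓘(ℝ, ℝ) I c' 0 := h.mfderiv_eq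
  exact congrArg (fun l : ℝ →L[ℝ] E => l 1) this

/-- On velocities of curves in `S`, the choice made by `mfderivWithin` of a derivative within `S`
is immaterial. -/
lemma mfderivWithin_velocity {S : Set N} {x : N} {c : ℝ → N} {f : N → N'}
    (hc : IsCurveIn I S x c) (hf : ContMDiffOn I I' ∞ f S) :
    mfderivWithin I I' f S x (velocity I x c) = velocity I' (f x) (fun τ => f (c τ)) := by
  have hc' := hc.contMDiffAt
  obtain ⟨rfl, ε, hε, h, hS⟩ := hc
  -- The set `S` need not have unique derivatives, but the interval on which `c` lies in `S` does.
  have h0 : (0 : ℝ) ∈ Ioo (-ε) ε := ⟨by linarith, hε⟩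
  have h1 := ((hf _ (hS 0 h0)).mdifferentiableWithinAt (by simp)).hasMFDerivWithinAt
  have h2 := (hc'.mdifferentiableAt (by simp)).hasMFDerivAt
  have h3 := (h1.comp 0 (h2.hasMFDerivWithinAt (s := Ioo (-ε) ε)) hS).hasMFDerivAt
    (Ioo_mem_nhds h0.1 h0.2)
  have h4 := h3.mfderiv
  change _ = mfderiv 𝓘(ℝ, ℝ) I' (f ∘ c) 0 (1 : ℝ)
  rw [h4]
  rfl

lemma FormField.pullbackOn_velocity {S : Set N} {x : N} {c : Fin k → ℝ → N} {f : N → N'}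
    (α : FormField I' N' k) (hc : ∀ i, IsCurveIn I S x (c i)) (hf : ContMDiffOn I I' ∞ f S) :
    (α.pullbackOn S f : FormField I N k) x (fun i => velocity I x (c i))
      = α (f x) (fun i => velocity I' (f x) (fun τ => f (c i τ))) := by
  change α (f x) (fun i => mfderivWithin I I' f S x (velocity I x (c i))) = _
  simp only [mfderivWithin_velocity (hc _) hf]

lemma FormField.pullback_velocity {S : Set N} {x : N} {c : Fin k → ℝ → N} {f : N → N'}
    (α : FormField I' N' k) (hc : ∀ i, IsCurveIn I S x (c i)) (hf : ContMDiff I I' ∞ f) :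
    (α.pullback f : FormField I N k) x (fun i => velocity I x (c i))
      = α (f x) (fun i => velocity I' (f x) (fun τ => f (c i τ))) := by
  rw [← pullbackOn_velocity (S := univ) α ?_ hf.contMDiffOn]
  · simp only [FormField.pullback, FormField.pullbackOn, mfderivWithin_univ]
  · exact fun i => (hc i).comp (f := id) contMDiffOn_id (mapsTo_univ _ _)

end Velocity

/-! ### Charts adapted to a graph -/

section Graph

variable {V : Type*} [NormedAddCommGroup V] [NormedSpace ℝ V]
  {A : Type*} [NormedAddCommGroup A] [NormedSpace ℝ A]
  {B : Type*} [NormedAddCommGroup B] [NormedSpace ℝ B]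

lemma ModelWithCorners.right_inv_of_boundaryless {H : Type*} [TopologicalSpace H]
    (I : ModelWithCorners ℝ V H) [I.Boundaryless] (v : V) : I (I.symm v) = v :=
  I.right_inv (by simp [I.range_eq_univ])

/-- The shear `(a, b) ↦ (a, b - f a)` over the open set `D`, transported to the model space of a
model with corners without boundary by a linear isomorphism `L : V ≃ A × B`. -/
def shear {H : Type*} [TopologicalSpace H] (I : ModelWithCorners ℝ V H) [I.Boundaryless]
    (L : V ≃L[ℝ] A × B) {D : Set A} (hD : IsOpen D) {f : A → B} (hf : ContinuousOn f D) :
    OpenPartialHomeomorph H H where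
  toFun z := I.symm (I z - L.symm (0, f (L (I z)).1))
  invFun z := I.symm (I z + L.symm (0, f (L (I z)).1))
  source := {z | (L (I z)).1 ∈ D}
  target := {z | (L (I z)).1 ∈ D}
  map_source' z hz := by simpa [I.right_inv_of_boundaryless] using hz
  map_target' z hz := by simpa [I.right_inv_of_boundaryless] using hz
  left_inv' z hz := by simp [I.right_inv_of_boundaryless]
  right_inv' z hz := by simp [I.right_inv_of_boundaryless]
  open_source := hD.preimage (continuous_fst.comp (L.continuous.comp I.continuous))
  open_target := hD.preimage (continuous_fst.comp (L.continuous.comp I.continuous))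
  continuousOn_toFun := by
    have : ContinuousOn (fun z => f (L (I z)).1) {z | (L (I z)).1 ∈ D} :=
      hf.comp (continuous_fst.comp (L.continuous.comp I.continuous)).continuousOn fun z hz => hz
    exact I.continuous_symm.comp_continuousOn (I.continuous.continuousOn.sub
      (L.symm.continuous.comp_continuousOn (continuousOn_const.prodMk this)))
  continuousOn_invFun := by
    have : ContinuousOn (fun z => f (L (I z)).1) {z | (L (I z)).1 ∈ D} :=
      hf.comp (continuous_fst.comp (L.continuous.comp I.continuous)).continuousOn fun z hz => hz
    exact I.continuous_symm.comp_continuousOn (I.continuous.continuousOn.add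
      (L.symm.continuous.comp_continuousOn (continuousOn_const.prodMk this)))

lemma shear_mem_contDiffGroupoid {H : Type*} [TopologicalSpace H] (I : ModelWithCorners ℝ V H)
    [I.Boundaryless] (L : V ≃L[ℝ] A × B) {D : Set A} (hD : IsOpen D) {f : A → B}
    (hf : ContDiffOn ℝ ∞ f D) : shear I L hD hf.continuousOn ∈ contDiffGroupoid ∞ I := by
  have h1 : ContDiffOn ℝ ∞ (fun v => f (L v).1) {v | (L v).1 ∈ D} :=
    hf.comp (by fun_prop : ContDiff ℝ ∞ fun v => (L v).1).contDiffOn fun v hv => hv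
  have h2 : ContDiffOn ℝ ∞ (fun v => L.symm (0, f (L v).1)) {v | (L v).1 ∈ D} :=
    L.symm.contDiff.comp_contDiffOn (contDiffOn_const.prodMk h1)
  rw [contDiffGroupoid, mem_groupoid_of_pregroupoid]
  constructor
  · change ContDiffOn ℝ ∞ _ _
    refine ((contDiffOn_id.sub h2).mono fun v hv => ?_).congr fun v hv => ?_
    · simpa [shear, I.right_inv_of_boundaryless] using hv.1
    · simp [shear, I.right_inv_of_boundaryless]
  · change ContDiffOn ℝ ∞ _ _
    refine ((contDiffOn_id.add h2).mono fun v hv => ?_).congr fun v hv => ?_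
    · simpa [shear, I.right_inv_of_boundaryless] using hv.1
    · simp [shear, I.right_inv_of_boundaryless]

lemma trans_mem_maximalAtlas {H : Type*} [TopologicalSpace H] {N : Type*} [TopologicalSpace N]
    [ChartedSpace H N] {𝒮 : StructureGroupoid H} {φ : OpenPartialHomeomorph N H}
    {σ : OpenPartialHomeomorph H H} (hφ : φ ∈ 𝒮.maximalAtlas N) (hσ : σ ∈ 𝒮) :
    φ.trans σ ∈ 𝒮.maximalAtlas N := by
  rw [mem_maximalAtlas_iff] at hφ ⊢
  intro e he
  rw [OpenPartialHomeomorph.trans_symm_eq_symm_trans_symm, OpenPartialHomeomorph.trans_assoc,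
    ← OpenPartialHomeomorph.trans_assoc e.symm]
  exact ⟨𝒮.trans (𝒮.symm hσ) (hφ e he).1, 𝒮.trans (hφ e he).2 hσ⟩

/-- Near a point at which, in some chart with values in `V ≃ A × B`, a set `S` is the graph of a
smooth map `A → B`, there is a chart in which `S` is a linear subspace of dimension `dim A`. -/
theorem exists_submanifold_chart_of_graph {H : Type*} [TopologicalSpace H]
    {I : ModelWithCorners ℝ V H} [I.Boundaryless] {N : Type*} [TopologicalSpace N]
    [ChartedSpace H N] {S : Set N} {x : N} (hxS : x ∈ S) {φ : OpenPartialHomeomorph N H}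
    (hφ : φ ∈ IsManifold.maximalAtlas I ∞ N) (hx : x ∈ φ.source) (L : V ≃L[ℝ] A × B) {f : A → B}
    (hf : ∀ᶠ a in 𝓝 (L (φ.extend I x)).1, ContDiffAt ℝ ∞ f a)
    (hS : ∀ᶠ y in 𝓝 x, y ∈ S ↔ (L (φ.extend I y)).2 = f (L (φ.extend I y)).1) :
    ∃ φ ∈ IsManifold.maximalAtlas I ∞ N, x ∈ φ.source ∧
      ∃ W : Submodule ℝ V, Module.finrank ℝ W = Module.finrank ℝ A ∧
        ∀ y ∈ φ.source, y ∈ S ↔ φ.extend I y - φ.extend I x ∈ W := by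
  obtain ⟨D, hDf, hD, hxD⟩ := eventually_nhds_iff.1 hf
  obtain ⟨U, hUS, hU, hxU⟩ := eventually_nhds_iff.1 hS
  have hfD : ContDiffOn ℝ ∞ f D := fun a ha => (hDf a ha).contDiffWithinAt
  set σ := shear I L hD hfD.continuousOn with hσ
  have hΨ : ((φ.restr U).trans σ) ∈ IsManifold.maximalAtlas I ∞ N := by
    refine trans_mem_maximalAtlas ?_ (shear_mem_contDiffGroupoid I L hD hfD)
    exact restr_mem_maximalAtlas (contDiffGroupoid ∞ I) hφ hU
  have hval : ∀ y, ((φ.restr U).trans σ).extend I y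
      = φ.extend I y - L.symm (0, f (L (φ.extend I y)).1) := by
    intro y
    simp [hσ, shear, I.right_inv_of_boundaryless]
  have hsrc : ∀ y, y ∈ ((φ.restr U).trans σ).source ↔
      (y ∈ φ.source ∧ y ∈ U) ∧ (L (φ.extend I y)).1 ∈ D := by
    intro y
    simp [hσ, shear, hU.interior_eq]
  -- In the sheared chart, `S` consists of the points with vanishing component in `B`.
  refine ⟨_, hΨ, (hsrc x).2 ⟨⟨hx, hxU⟩, hxD⟩,
    LinearMap.ker ((LinearMap.snd ℝ A B).comp L.toLinearEquiv.toLinearMap), ?_, ?_⟩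
  · have e : LinearMap.ker ((LinearMap.snd ℝ A B).comp L.toLinearEquiv.toLinearMap)
        = (LinearMap.range (LinearMap.inl ℝ A B)).map L.symm.toLinearEquiv.toLinearMap := by
      rw [LinearMap.range_inl]
      ext v
      simp only [LinearMap.mem_ker, Submodule.mem_map]
      constructor
      · intro h
        exact ⟨L v, h, by simp⟩
      · rintro ⟨w, hw, rfl⟩
        simpa using hw
    rw [e, LinearEquiv.finrank_map_eq, LinearMap.finrank_range_of_inj LinearMap.inl_injective]
  · intro y hy
    have hy' := (hsrc y).1 hy
    have h0 := (hUS x hxU).1 hxS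
    rw [hUS y hy'.1.2, hval, hval]
    have h1 : ∀ z, (L (φ.extend I z - L.symm (0, f (L (φ.extend I z)).1))).2
        = (L (φ.extend I z)).2 - f (L (φ.extend I z)).1 := fun z => by simp
    simp only [LinearMap.mem_ker, LinearMap.comp_apply, map_sub, LinearMap.snd_apply,
      ContinuousLinearEquiv.coe_toLinearEquiv, LinearEquiv.coe_coe, Prod.snd_sub] at h1 ⊢
    rw [h1, h1, h0, sub_self, sub_zero, sub_eq_zero]

end Graph

/-! ### Affine forms and parallelograms -/

section Affine

variable {E : Type*} [NormedAddCommGroup E] [NormedSpace ℝ E]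
  {F : Type*} [NormedAddCommGroup F] [NormedSpace ℝ F]
  {G : Type*} [TopologicalSpace G] [ChartedSpace E G]
  {M : Type*} [TopologicalSpace M] [ChartedSpace F M] {k : ℕ}
  {V : Type*} [NormedAddCommGroup V] [NormedSpace ℝ V]
  {H : Type*} [TopologicalSpace H] {I : ModelWithCorners ℝ V H}
  {N : Type*} [TopologicalSpace N] [ChartedSpace H N]

/-- The value `(f^* Θ)(c₁'(0), …, c_k'(0))` at `x`, for a map `f : N → G` and curves `cᵢ` in `N`
through `x`, computed from the curves `f ∘ cᵢ`. This depends only on the values of `f` along the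
curves, so `f` may be smooth merely on a submanifold that contains them. -/
def FormField.alongCurves (Θ : FormField 𝓘(ℝ, E) G k) (x : N) (c : Fin k → ℝ → N) (f : N → G) : ℝ :=
  Θ (f x) fun i => velocity 𝓘(ℝ, E) (f x) fun τ => f (c i τ)

lemma FormField.alongCurves_congr (Θ : FormField 𝓘(ℝ, E) G k) {S : Set N} {x : N} (hx : x ∈ S)
    {c : Fin k → ℝ → N} (hc : ∀ i, IsCurveIn I S x (c i)) {f f' : N → G} (h : EqOn f f' S) :
    Θ.alongCurves x c f = Θ.alongCurves x c f' := by
  unfold alongCurves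
  rw [h hx]
  congr 1
  funext i
  refine velocity_congr _ ?_
  filter_upwards [(hc i).eventually_mem] with τ hτ using h hτ

lemma alternatingSum_velocity (Θ : FormField 𝓘(ℝ, E) G k) {S : Set (G × G × G × G)}
    {x : G × G × G × G} {c : Fin k → ℝ → G × G × G × G}
    (hc : ∀ i, IsCurveIn (𝓘(ℝ, E).prod (𝓘(ℝ, E).prod (𝓘(ℝ, E).prod 𝓘(ℝ, E)))) S x (c i)) :
    alternatingSum Θ x (fun i => velocity _ x (c i))
      = Θ.alongCurves x c (fun q => q.1) - Θ.alongCurves x c (fun q => q.2.1)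
        - Θ.alongCurves x c (fun q => q.2.2.1) + Θ.alongCurves x c (fun q => q.2.2.2) := by
  unfold FormField.alongCurves
  rw [← Θ.pullback_velocity hc contMDiff_fst,
    ← Θ.pullback_velocity hc (f := fun q => q.2.1) (contMDiff_fst.comp contMDiff_snd),
    ← Θ.pullback_velocity hc (f := fun q => q.2.2.1)
      (contMDiff_fst.comp (contMDiff_snd.comp contMDiff_snd)),
    ← Θ.pullback_velocity hc (f := fun q => q.2.2.2)
      (contMDiff_snd.comp (contMDiff_snd.comp contMDiff_snd))]
  rfl

namespace LieGroupoid

variable (𝒢 : LieGroupoid E F G M)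

/-- The defining equation of an affine form, evaluated on velocities of curves of composable
arrows. -/
lemma isAffine_iff (Θ : FormField 𝓘(ℝ, E) G k) :
    𝒢.IsAffine Θ ↔ ∀ x ∈ 𝒢.composable, ∀ c : Fin k → ℝ → G × G,
      (∀ i, IsCurveIn (𝓘(ℝ, E).prod 𝓘(ℝ, E)) 𝒢.composable x (c i)) →
      Θ.alongCurves x c (fun p => 𝒢.mul p.1 p.2)
        = Θ.alongCurves x c Prod.fst + Θ.alongCurves x c Prod.snd
          - Θ.alongCurves x c (fun p => 𝒢.unit (𝒢.src p.1)) := by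
  unfold IsAffine
  rw [FormField.eqOnSubmanifold_iff]
  refine forall₄_congr fun x hx c hc => ?_
  rw [Θ.pullbackOn_velocity hc 𝒢.contMDiffOn_mul]
  have h1 := Θ.pullback_velocity hc contMDiff_fst
  have h2 := Θ.pullback_velocity hc contMDiff_snd
  have hc1 : ∀ i, IsCurveIn 𝓘(ℝ, E) univ x.1 (fun τ => (c i τ).1) := fun i =>
    (hc i).comp contMDiff_fst.contMDiffOn (mapsTo_univ _ _)
  have hc2 : ∀ i, IsCurveIn 𝓘(ℝ, F) univ (𝒢.src x.1) (fun τ => 𝒢.src (c i τ).1) := fun i =>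
    (hc1 i).comp 𝒢.isSubmersion_src.contMDiff.contMDiffOn (mapsTo_univ _ _)
  have h3 := ((𝒢.baseForm Θ).pullback (I := 𝓘(ℝ, E)) 𝒢.src).pullback_velocity hc contMDiff_fst
  rw [FormField.pullback_velocity _ hc1 𝒢.isSubmersion_src.contMDiff, baseForm,
    FormField.pullback_velocity _ hc2 𝒢.contMDiff_unit] at h3
  unfold FormField.alongCurves
  rw [← h1, ← h2, ← h3]
  rfl

/-- The defining equation of an affine form, pulled back under a pair `(a, b)` of composable arrows
that depends smoothly on a point of `S`. -/
lemma IsAffine.alongCurves_mul {𝒢 : LieGroupoid E F G M} {Θ : FormField 𝓘(ℝ, E) G k}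
    (h : 𝒢.IsAffine Θ) {S : Set N} {x : N} (hx : x ∈ S) {c : Fin k → ℝ → N}
    (hc : ∀ i, IsCurveIn I S x (c i)) {a b : N → G} (ha : ContMDiffOn I 𝓘(ℝ, E) ∞ a S)
    (hb : ContMDiffOn I 𝓘(ℝ, E) ∞ b S) (hab : ∀ y ∈ S, 𝒢.src (a y) = 𝒢.tgt (b y)) :
    Θ.alongCurves x c (fun y => 𝒢.mul (a y) (b y))
      = Θ.alongCurves x c a + Θ.alongCurves x c b
        - Θ.alongCurves x c (fun y => 𝒢.unit (𝒢.src (a y))) :=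
  (𝒢.isAffine_iff Θ).1 h (a x, b x) (hab x hx) (fun i τ => (a (c i τ), b (c i τ))) fun i =>
    (hc i).comp (ha.prodMk hb) hab

lemma inv_unit (x : M) : 𝒢.inv (𝒢.unit x) = 𝒢.unit x := by
  have h1 := 𝒢.mul_inv (𝒢.unit x)
  have h2 := 𝒢.unit_mul (𝒢.inv (𝒢.unit x))
  rw [𝒢.tgt_unit] at h1
  rwa [𝒢.tgt_inv, 𝒢.src_unit, h1, eq_comm] at h2

lemma mul_inv_mul_composable {g h l : G} (hs : 𝒢.src g = 𝒢.src h) (ht : 𝒢.tgt g = 𝒢.tgt l) :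
    𝒢.src (𝒢.mul h (𝒢.inv g)) = 𝒢.tgt l := by
  rw [𝒢.src_mul _ _ (by rw [𝒢.tgt_inv, hs]), 𝒢.src_inv, ht]

lemma mem_parallelograms_iff {p : G × G × G × G} :
    p ∈ 𝒢.parallelograms ↔ 𝒢.src p.1 = 𝒢.src p.2.1 ∧ 𝒢.tgt p.1 = 𝒢.tgt p.2.2.1 ∧
      p.2.2.2 = 𝒢.mul (𝒢.mul p.2.1 (𝒢.inv p.1)) p.2.2.1 := by
  constructor
  · rintro ⟨g, h, l, hs, ht, rfl⟩
    exact ⟨hs, ht, rfl⟩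
  · rintro ⟨hs, ht, h⟩
    exact ⟨p.1, p.2.1, p.2.2.1, hs, ht, by rw [← h]⟩

/-- An affine form restricts to zero on parallelograms: `h g⁻¹ l` is a product of arrows, and the
form at `g⁻¹` is determined by the product `g g⁻¹`, which is a unit. -/
theorem IsAffine.eqOnSubmanifold_parallelograms {𝒢 : LieGroupoid E F G M}
    {Θ : FormField 𝓘(ℝ, E) G k} (h : 𝒢.IsAffine Θ) :
    (alternatingSum Θ).EqOnSubmanifold (fun _ => 0) 𝒢.parallelograms := by
  rw [FormField.eqOnSubmanifold_iff]
  intro x hx c hc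
  rw [alternatingSum_velocity Θ hc]
  have hΓ : ∀ y ∈ 𝒢.parallelograms, 𝒢.src y.1 = 𝒢.src y.2.1 ∧ 𝒢.tgt y.1 = 𝒢.tgt y.2.2.1 ∧
      y.2.2.2 = 𝒢.mul (𝒢.mul y.2.1 (𝒢.inv y.1)) y.2.2.1 := fun y => 𝒢.mem_parallelograms_iff.1
  have s1 : ContMDiffOn (𝓘(ℝ, E).prod (𝓘(ℝ, E).prod (𝓘(ℝ, E).prod 𝓘(ℝ, E)))) 𝓘(ℝ, E) ∞
      (fun y : G × G × G × G => y.1) 𝒢.parallelograms := contMDiff_fst.contMDiffOn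
  have s2 : ContMDiffOn (𝓘(ℝ, E).prod (𝓘(ℝ, E).prod (𝓘(ℝ, E).prod 𝓘(ℝ, E)))) 𝓘(ℝ, E) ∞
      (fun y : G × G × G × G => y.2.1) 𝒢.parallelograms :=
    (contMDiff_fst.comp contMDiff_snd).contMDiffOn
  have s3 : ContMDiffOn (𝓘(ℝ, E).prod (𝓘(ℝ, E).prod (𝓘(ℝ, E).prod 𝓘(ℝ, E)))) 𝓘(ℝ, E) ∞
      (fun y : G × G × G × G => y.2.2.1) 𝒢.parallelograms :=
    (contMDiff_fst.comp (contMDiff_snd.comp contMDiff_snd)).contMDiffOn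
  have sinv := 𝒢.contMDiff_inv.comp_contMDiffOn s1
  have hcomp : ∀ y ∈ 𝒢.parallelograms, 𝒢.src y.2.1 = 𝒢.tgt (𝒢.inv y.1) := fun y hy => by
    rw [𝒢.tgt_inv, (hΓ y hy).1]
  have sq : ContMDiffOn (𝓘(ℝ, E).prod (𝓘(ℝ, E).prod (𝓘(ℝ, E).prod 𝓘(ℝ, E)))) 𝓘(ℝ, E) ∞
      (fun y : G × G × G × G => 𝒢.mul y.2.1 (𝒢.inv y.1)) 𝒢.parallelograms :=
    𝒢.contMDiffOn_mul.comp (s2.prodMk sinv) hcomp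
  -- The three products are `g g⁻¹`, `h g⁻¹` and `(h g⁻¹) l`; along parallelograms, the first is the
  -- unit at `t(g)`, `s(h) = s(g)` and `s(h g⁻¹) = t(g)`.
  have e1 := h.alongCurves_mul hx hc s1 sinv fun y _ => (𝒢.tgt_inv y.1).symm
  have e2 := h.alongCurves_mul hx hc s2 sinv hcomp
  have e3 := h.alongCurves_mul hx hc sq s3 fun y hy =>
    𝒢.mul_inv_mul_composable (hΓ y hy).1 (hΓ y hy).2.1
  have c1 := Θ.alongCurves_congr hx hc (f := fun y => 𝒢.mul y.1 (𝒢.inv y.1))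
    (f' := fun y => 𝒢.unit (𝒢.tgt y.1)) fun y _ => 𝒢.mul_inv y.1
  have c2 := Θ.alongCurves_congr hx hc (f := fun y => 𝒢.unit (𝒢.src y.2.1))
    (f' := fun y => 𝒢.unit (𝒢.src y.1)) fun y hy => congrArg 𝒢.unit (hΓ y hy).1.symm
  have c3 := Θ.alongCurves_congr hx hc (f := fun y => 𝒢.unit (𝒢.src (𝒢.mul y.2.1 (𝒢.inv y.1))))
    (f' := fun y => 𝒢.unit (𝒢.tgt y.1)) fun y hy => by
      simp only [𝒢.src_mul _ _ (hcomp y hy), 𝒢.src_inv]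
  have c4 := Θ.alongCurves_congr hx hc (f := fun y => y.2.2.2)
    (f' := fun y => 𝒢.mul (𝒢.mul y.2.1 (𝒢.inv y.1)) y.2.2.1) fun y hy => (hΓ y hy).2.2
  simp only [Function.comp_def] at e1 e2
  change _ = (0 : ℝ)
  linarith

/-- If the form restricts to zero on parallelograms, then it is affine: the parallelogram
`(1, g, h, gh)` with `1` the unit at `s(g) = t(h)` gives the defining equation. -/
theorem isAffine_of_eqOnSubmanifold_parallelograms {Θ : FormField 𝓘(ℝ, E) G k}
    (h : (alternatingSum Θ).EqOnSubmanifold (fun _ => 0) 𝒢.parallelograms) : 𝒢.IsAffine Θ := by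
  rw [FormField.eqOnSubmanifold_iff] at h
  rw [isAffine_iff]
  intro x hx c hc
  set f : G × G → G × G × G × G :=
    fun p => (𝒢.unit (𝒢.src p.1), p.1, p.2, 𝒢.mul p.1 p.2) with hf
  have hfs : ContMDiffOn (𝓘(ℝ, E).prod 𝓘(ℝ, E))
      (𝓘(ℝ, E).prod (𝓘(ℝ, E).prod (𝓘(ℝ, E).prod 𝓘(ℝ, E)))) ∞ f 𝒢.composable :=
    (𝒢.contMDiff_unit.comp (𝒢.isSubmersion_src.contMDiff.comp contMDiff_fst)).contMDiffOn.prodMk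
      (contMDiffOn_fst.prodMk (contMDiffOn_snd.prodMk 𝒢.contMDiffOn_mul))
  have hfm : MapsTo f 𝒢.composable 𝒢.parallelograms := by
    intro p hp
    rw [mem_parallelograms_iff]
    refine ⟨𝒢.src_unit _, (𝒢.tgt_unit _).trans hp, ?_⟩
    simp only [hf, 𝒢.inv_unit, 𝒢.mul_unit]
  have hcf := fun i => (hc i).comp hfs hfm
  have key := h (f x) (hfm hx) _ hcf
  rw [alternatingSum_velocity Θ hcf] at key
  change Θ.alongCurves x c (fun p => 𝒢.unit (𝒢.src p.1)) - Θ.alongCurves x c Prod.fst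
    - Θ.alongCurves x c Prod.snd + Θ.alongCurves x c (fun p => 𝒢.mul p.1 p.2) = (0 : ℝ) at key
  linarith

end LieGroupoid

end Affine

/-! ### The submanifold of parallelograms -/

section Submanifold

variable {E : Type*} [NormedAddCommGroup E] [NormedSpace ℝ E]
  {F : Type*} [NormedAddCommGroup F] [NormedSpace ℝ F]
  {G : Type*} [TopologicalSpace G] [ChartedSpace E G]
  {M : Type*} [TopologicalSpace M] [ChartedSpace F M]

/-- The linear isomorphism that reorders coordinates `(a, b, c, d)` on `G⁴`, where
`b = (b₁, b₂)` and `c = (c₁, c₂)` in charts adapted to two submersions, into the free coordinates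
`(a, b₂, c₂)` and the coordinates `(b₁, c₁, d)` that depend on them along parallelograms. -/
def splitCoordinates {K K' : Type*} [NormedAddCommGroup K] [NormedSpace ℝ K]
    [NormedAddCommGroup K'] [NormedSpace ℝ K'] (P : E ≃L[ℝ] F × K) (P' : E ≃L[ℝ] F × K') :
    (E × E × E × E) ≃L[ℝ] (E × K × K') × (F × F × E) where
  toFun v := ((v.1, (P v.2.1).2, (P' v.2.2.1).2), ((P v.2.1).1, (P' v.2.2.1).1, v.2.2.2))
  invFun w := (w.1.1, P.symm (w.2.1, w.1.2.1), P'.symm (w.2.2.1, w.1.2.2), w.2.2.2)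
  map_add' v w := by simp
  map_smul' a v := by simp
  left_inv v := by simp
  right_inv w := by simp
  continuous_toFun := by fun_prop
  continuous_invFun := by fun_prop

/-- In charts adapted to a submersion `f`, the first component of the coordinates of `y` is the
coordinate expression of `f y`. -/
lemma equiv_domChart_fst {f : G → M} {x : G}
    (hf : Manifold.IsSubmersionAt 𝓘(ℝ, E) 𝓘(ℝ, F) ∞ f x) {y : G} (hy : y ∈ hf.domChart.source) :
    (hf.equiv (hf.domChart y)).1 = hf.codChart (f y) := by
  have h : hf.domChart y ∈ (hf.domChart.extend 𝓘(ℝ, E)).target := by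
    simpa using hf.domChart.map_source hy
  simpa [hf.domChart.left_inv hy] using (hf.writtenInCharts h).symm

/-- The point with coordinates `(f y, b)`, where `b` is the component of `y` in the complement, is
`y`. -/
lemma lift_self {f : G → M} {x : G} (hf : Manifold.IsSubmersionAt 𝓘(ℝ, E) 𝓘(ℝ, F) ∞ f x) {y : G}
    (hy : y ∈ hf.domChart.source) :
    hf.domChart.symm (hf.equiv.symm (hf.codChart (f y), (hf.equiv (hf.domChart y)).2)) = y := by
  rw [← equiv_domChart_fst hf hy, Prod.mk.eta, ContinuousLinearEquiv.symm_apply_apply,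
    hf.domChart.left_inv hy]

/-- In charts adapted to a submersion `f` near `x`, a point is determined by its image under `f`
and by its component `b` in the complement: if `γ` and `β` are smooth with values in `M` and in the
complement, then `a ↦ κ⁻¹ (ψ (γ a), β a)` is a smooth lift of `γ`. -/
lemma contMDiffAt_lift [IsManifold 𝓘(ℝ, E) ∞ G] [IsManifold 𝓘(ℝ, F) ∞ M] {f : G → M} {x : G}
    (hf : Manifold.IsSubmersionAt 𝓘(ℝ, E) 𝓘(ℝ, F) ∞ f x)
    {A : Type*} [NormedAddCommGroup A] [NormedSpace ℝ A] {γ : A → M} {β : A → hf.complement}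
    {a₀ : A} (hγ : ∀ᶠ a in 𝓝 a₀, ContMDiffAt 𝓘(ℝ, A) 𝓘(ℝ, F) ∞ γ a)
    (hβ : ContDiff ℝ ∞ β) (hγx : γ a₀ = f x) (hβx : β a₀ = (hf.equiv (hf.domChart x)).2) :
    ∀ᶠ a in 𝓝 a₀,
      ContMDiffAt 𝓘(ℝ, A) 𝓘(ℝ, E) ∞
        (fun a => hf.domChart.symm (hf.equiv.symm (hf.codChart (γ a), β a))) a ∧
      f (hf.domChart.symm (hf.equiv.symm (hf.codChart (γ a), β a))) = γ a := by
  have hγs : ∀ᶠ a in 𝓝 a₀, γ a ∈ hf.codChart.source :=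
    hγ.self_of_nhds.continuousAt.eventually_mem
      (hf.codChart.open_source.mem_nhds (hγx ▸ hf.mem_codChart_source))
  have hw : ∀ᶠ a in 𝓝 a₀, ContMDiffAt 𝓘(ℝ, A) 𝓘(ℝ, E) ∞
      (fun a => hf.equiv.symm (hf.codChart (γ a), β a)) a := by
    filter_upwards [hγ, hγs] with a ha has
    have h1 : ContMDiffAt 𝓘(ℝ, A) 𝓘(ℝ, F) ∞ (fun a => hf.codChart (γ a)) a :=
      (contMDiffAt_of_mem_maximalAtlas hf.codChart_mem_maximalAtlas has).comp a ha
    rw [contMDiffAt_iff_contDiffAt] at h1 ⊢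
    exact hf.equiv.symm.contDiff.contDiffAt.comp a (h1.prodMk hβ.contDiffAt)
  have hw0 : hf.equiv.symm (hf.codChart (γ a₀), β a₀) = hf.domChart x := by
    rw [hγx, hβx, ← equiv_domChart_fst hf hf.mem_domChart_source]
    simp
  have hwt : ∀ᶠ a in 𝓝 a₀, hf.equiv.symm (hf.codChart (γ a), β a) ∈ hf.domChart.target :=
    hw.self_of_nhds.continuousAt.eventually_mem (hf.domChart.open_target.mem_nhds
      (hw0 ▸ hf.domChart.map_source hf.mem_domChart_source))
  filter_upwards [hw, hwt, hγs] with a ha hat has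
  refine ⟨(contMDiffAt_symm_of_mem_maximalAtlas hf.domChart_mem_maximalAtlas hat).comp a ha, ?_⟩
  have hs := hf.domChart.map_target hat
  refine hf.codChart.injOn (hf.source_subset_preimage_source hs) has ?_
  rw [← equiv_domChart_fst hf hs, hf.domChart.right_inv hat]
  simp

lemma finrank_complement [FiniteDimensional ℝ E] [FiniteDimensional ℝ F] {f : G → M} {x : G}
    (hf : Manifold.IsSubmersionAt 𝓘(ℝ, E) 𝓘(ℝ, F) ∞ f x) :
    FiniteDimensional ℝ hf.complement ∧
      Module.finrank ℝ E = Module.finrank ℝ F + Module.finrank ℝ hf.complement := by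
  have : FiniteDimensional ℝ (F × hf.complement) :=
    hf.equiv.toLinearEquiv.finiteDimensional
  have h : FiniteDimensional ℝ hf.complement :=
    Module.Finite.of_surjective (LinearMap.snd ℝ F hf.complement) Prod.snd_surjective
  exact ⟨h, by rw [hf.equiv.toLinearEquiv.finrank_eq, Module.finrank_prod]⟩

lemma eq_map_iff {f : G → M} {x : G}
    (hf : Manifold.IsSubmersionAt 𝓘(ℝ, E) 𝓘(ℝ, F) ∞ f x) {y : G} (hy : y ∈ hf.domChart.source)
    {z : M} (hz : z ∈ hf.codChart.source) :
    z = f y ↔ (hf.equiv (hf.domChart y)).1 = hf.codChart z := by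
  rw [equiv_domChart_fst hf hy]
  exact ⟨fun e => by rw [e], fun e =>
    (hf.codChart.injOn (hf.source_subset_preimage_source hy) hz e).symm⟩

namespace LieGroupoid

variable (𝒢 : LieGroupoid E F G M)

/-- A product of smooth families of arrows is smooth if they are composable for all nearby
parameters: the multiplication is smooth within the set of composable pairs, which suffices. -/
lemma contMDiffAt_mul_comp {A : Type*} [NormedAddCommGroup A] [NormedSpace ℝ A] {u v : A → G}
    {a : A} (hu : ContMDiffAt 𝓘(ℝ, A) 𝓘(ℝ, E) ∞ u a) (hv : ContMDiffAt 𝓘(ℝ, A) 𝓘(ℝ, E) ∞ v a)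
    (huv : ∀ᶠ b in 𝓝 a, 𝒢.src (u b) = 𝒢.tgt (v b)) :
    ContMDiffAt 𝓘(ℝ, A) 𝓘(ℝ, E) ∞ (fun b => 𝒢.mul (u b) (v b)) a := by
  have h := (𝒢.contMDiffOn_mul (u a, v a) huv.self_of_nhds).comp a
    (s := {b | 𝒢.src (u b) = 𝒢.tgt (v b)}) (hu.prodMk hv).contMDiffWithinAt fun b hb => hb
  exact h.contMDiffAt huv

set_option maxHeartbeats 1000000 in
/-- Parallelograms `(g, h, l, h g⁻¹ l)` form a submanifold. In charts in which the source near `h`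
and the target near `l` are linear projections, the coordinates of `g` and the fibre coordinates of
`h` and `l` are free, while `s(h) = s(g)`, `t(l) = t(g)` and `h g⁻¹ l` are smooth functions of
them. -/
theorem isSubmanifold_parallelograms [FiniteDimensional ℝ E] [FiniteDimensional ℝ F]
    [IsManifold 𝓘(ℝ, E) ∞ G] [IsManifold 𝓘(ℝ, F) ∞ M] :
    IsSubmanifold (𝓘(ℝ, E).prod (𝓘(ℝ, E).prod (𝓘(ℝ, E).prod 𝓘(ℝ, E)))) 𝒢.parallelograms
      (3 * Module.finrank ℝ E - 2 * Module.finrank ℝ F) := by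
  rintro x hx
  obtain ⟨hxs, hxt, hxm⟩ := 𝒢.mem_parallelograms_iff.1 hx
  have hs := 𝒢.isSubmersion_src.isSubmersionAt x.2.1
  have ht := 𝒢.isSubmersion_tgt.isSubmersionAt x.2.2.1
  obtain ⟨_, hKs⟩ := finrank_complement hs
  obtain ⟨_, hKt⟩ := finrank_complement ht
  set φ := chartAt E x.1
  set χ := chartAt E x.2.2.2
  have hφ : φ ∈ IsManifold.maximalAtlas 𝓘(ℝ, E) ∞ G := IsManifold.chart_mem_maximalAtlas x.1
  have hχ : χ ∈ IsManifold.maximalAtlas 𝓘(ℝ, E) ∞ G := IsManifold.chart_mem_maximalAtlas x.2.2.2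
  have hxφ : x.1 ∈ φ.source := mem_chart_source E x.1
  have hxχ : x.2.2.2 ∈ χ.source := mem_chart_source E x.2.2.2
  have hxκ := hs.mem_domChart_source
  have hxκ' := ht.mem_domChart_source
  -- The free coordinates on `G⁴`, and the arrows `g`, `h`, `l` and `h g⁻¹ l` as functions of them.
  set α : G × G × G × G → E × hs.complement × ht.complement := fun y =>
    (φ y.1, (hs.equiv (hs.domChart y.2.1)).2, (ht.equiv (ht.domChart y.2.2.1)).2) with hα
  set g : E × hs.complement × ht.complement → G := fun a => φ.symm a.1 with hg
  set h : E × hs.complement × ht.complement → G := fun a =>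
    hs.domChart.symm (hs.equiv.symm (hs.codChart (𝒢.src (g a)), a.2.1)) with hh
  set l : E × hs.complement × ht.complement → G := fun a =>
    ht.domChart.symm (ht.equiv.symm (ht.codChart (𝒢.tgt (g a)), a.2.2)) with hl
  set m : E × hs.complement × ht.complement → G := fun a =>
    𝒢.mul (𝒢.mul (h a) (𝒢.inv (g a))) (l a) with hm
  have hgα : ∀ y : G × G × G × G, y.1 ∈ φ.source → g (α y) = y.1 := fun y hy => φ.left_inv hy
  have hmα : ∀ y : G × G × G × G, y.1 ∈ φ.source → y.2.1 ∈ hs.domChart.source →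
      y.2.2.1 ∈ ht.domChart.source → 𝒢.src y.1 = 𝒢.src y.2.1 → 𝒢.tgt y.1 = 𝒢.tgt y.2.2.1 →
      m (α y) = 𝒢.mul (𝒢.mul y.2.1 (𝒢.inv y.1)) y.2.2.1 := by
    intro y h1 h2 h3 e1 e2
    have eh : h (α y) = y.2.1 := by
      simp only [hh, hgα y h1, e1]
      exact lift_self hs h2
    have el : l (α y) = y.2.2.1 := by
      simp only [hl, hgα y h1, e2]
      exact lift_self ht h3
    simp only [hm, eh, el, hgα y h1]
  have hmx : m (α x) = x.2.2.2 := (hmα x hxφ hxκ hxκ' hxs hxt).trans hxm.symm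
  have sg : ∀ᶠ a in 𝓝 (α x), ContMDiffAt 𝓘(ℝ, E × hs.complement × ht.complement) 𝓘(ℝ, E) ∞ g a := by
    have : ∀ᶠ a : E × hs.complement × ht.complement in 𝓝 (α x), a.1 ∈ φ.target :=
      continuous_fst.continuousAt.eventually_mem (φ.open_target.mem_nhds (φ.map_source hxφ))
    filter_upwards [this] with a ha
    exact (contMDiffAt_symm_of_mem_maximalAtlas hφ ha).comp a contDiff_fst.contMDiff.contMDiffAt
  have sh := contMDiffAt_lift hs (a₀ := α x) (γ := fun a => 𝒢.src (g a)) (β := fun a => a.2.1)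
    (sg.mono fun a ha => 𝒢.isSubmersion_src.contMDiff.contMDiffAt.comp a ha) (by fun_prop)
    (by rw [hgα x hxφ, hxs]) rfl
  have sl := contMDiffAt_lift ht (a₀ := α x) (γ := fun a => 𝒢.tgt (g a)) (β := fun a => a.2.2)
    (sg.mono fun a ha => 𝒢.isSubmersion_tgt.contMDiff.contMDiffAt.comp a ha) (by fun_prop)
    (by rw [hgα x hxφ, hxt]) rfl
  have sm : ∀ᶠ a in 𝓝 (α x), ContMDiffAt 𝓘(ℝ, E × hs.complement × ht.complement) 𝓘(ℝ, E) ∞ m a := by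
    filter_upwards [sg, sh.eventually_nhds, sl.eventually_nhds] with a ga ha la
    refine 𝒢.contMDiffAt_mul_comp (𝒢.contMDiffAt_mul_comp ha.self_of_nhds.1
      (𝒢.contMDiff_inv.contMDiffAt.comp a ga) ?_) la.self_of_nhds.1 ?_
    · filter_upwards [ha] with b hb
      exact hb.2.trans (𝒢.tgt_inv _).symm
    · filter_upwards [ha, la] with b hb lb
      exact 𝒢.mul_inv_mul_composable hb.2.symm lb.2.symm
  have hmχ : ∀ᶠ a in 𝓝 (α x), m a ∈ χ.source :=
    sm.self_of_nhds.continuousAt.eventually_mem (χ.open_source.mem_nhds (hmx ▸ hxχ))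
  have hsg : ∀ᶠ a in 𝓝 (α x), 𝒢.src (g a) ∈ hs.codChart.source :=
    (𝒢.isSubmersion_src.contMDiff.continuous.continuousAt.comp
      sg.self_of_nhds.continuousAt).eventually_mem (hs.codChart.open_source.mem_nhds
        (by simpa only [Function.comp, hgα x hxφ, hxs] using hs.mem_codChart_source))
  have htg : ∀ᶠ a in 𝓝 (α x), 𝒢.tgt (g a) ∈ ht.codChart.source :=
    (𝒢.isSubmersion_tgt.contMDiff.continuous.continuousAt.comp
      sg.self_of_nhds.continuousAt).eventually_mem (ht.codChart.open_source.mem_nhds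
        (by simpa only [Function.comp, hgα x hxφ, hxt] using ht.mem_codChart_source))
  have hΦ : φ.prod (hs.domChart.prod (ht.domChart.prod χ)) ∈ IsManifold.maximalAtlas
      (𝓘(ℝ, E).prod (𝓘(ℝ, E).prod (𝓘(ℝ, E).prod 𝓘(ℝ, E)))) ∞ (G × G × G × G) :=
    IsManifold.mem_maximalAtlas_prod hφ (IsManifold.mem_maximalAtlas_prod
      hs.domChart_mem_maximalAtlas (IsManifold.mem_maximalAtlas_prod
        ht.domChart_mem_maximalAtlas hχ))
  have hΦx : x ∈ (φ.prod (hs.domChart.prod (ht.domChart.prod χ))).source :=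
    ⟨hxφ, hxκ, hxκ', hxχ⟩
  have hdim : Module.finrank ℝ (E × hs.complement × ht.complement)
      = 3 * Module.finrank ℝ E - 2 * Module.finrank ℝ F := by
    -- The subtraction does not truncate: the existence of a submersion forces `dim F ≤ dim E`.
    rw [Module.finrank_prod, Module.finrank_prod]
    omega
  have hαc : ContinuousAt α x :=
    (φ.continuousAt hxφ |>.comp continuous_fst.continuousAt).prodMk
      ((continuous_snd.continuousAt.comp (hs.equiv.continuous.continuousAt.comp
        ((hs.domChart.continuousAt hxκ).comp (f := fun y : G × G × G × G => y.2.1)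
          (by fun_prop)))).prodMk
      (continuous_snd.continuousAt.comp (ht.equiv.continuous.continuousAt.comp
        ((ht.domChart.continuousAt hxκ').comp (f := fun y : G × G × G × G => y.2.2.1)
          (by fun_prop)))))
  rw [← hdim]
  refine exists_submanifold_chart_of_graph hx hΦ hΦx (splitCoordinates hs.equiv ht.equiv)
    (f := fun a => (hs.codChart (𝒢.src (g a)), ht.codChart (𝒢.tgt (g a)), χ (m a))) ?_ ?_
  · change ∀ᶠ a in 𝓝 (α x), _
    filter_upwards [sg, sm, hmχ, hsg, htg] with a ga ma maχ sa ta
    refine ContDiffAt.prodMk ?_ (ContDiffAt.prodMk ?_ ?_) <;> rw [← contMDiffAt_iff_contDiffAt]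
    · exact (contMDiffAt_of_mem_maximalAtlas hs.codChart_mem_maximalAtlas sa).comp a
        (𝒢.isSubmersion_src.contMDiff.contMDiffAt.comp a ga)
    · exact (contMDiffAt_of_mem_maximalAtlas ht.codChart_mem_maximalAtlas ta).comp a
        (𝒢.isSubmersion_tgt.contMDiff.contMDiffAt.comp a ga)
    · exact (contMDiffAt_of_mem_maximalAtlas hχ maχ).comp a ma
  · filter_upwards [(φ.prod (hs.domChart.prod (ht.domChart.prod χ))).open_source.mem_nhds hΦx,
      hαc.eventually hmχ, hαc.eventually hsg, hαc.eventually htg] with y hy hmy hsy hty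
    obtain ⟨y1, y2, y3, y4⟩ := hy
    rw [hgα y y1] at hsy hty
    change _ ↔ ((hs.equiv (hs.domChart y.2.1)).1, (ht.equiv (ht.domChart y.2.2.1)).1, χ y.2.2.2)
      = (hs.codChart (𝒢.src (g (α y))), ht.codChart (𝒢.tgt (g (α y))), χ (m (α y)))
    rw [mem_parallelograms_iff, hgα y y1, Prod.mk.injEq, Prod.mk.injEq, ← eq_map_iff hs y2 hsy,
      ← eq_map_iff ht y3 hty]
    refine and_congr_right fun e1 => and_congr_right fun e2 => ?_
    rw [← hmα y y1 y2 y3 e1 e2]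
    exact ⟨fun e => by rw [e], fun e => χ.injOn y4 hmy e⟩

end LieGroupoid

end Submanifold

end

theorem mainTheorem12 {E : Type*} [NormedAddCommGroup E] [NormedSpace ℝ E] [FiniteDimensional ℝ E]
    {F : Type*} [NormedAddCommGroup F] [NormedSpace ℝ F] [FiniteDimensional ℝ F]
    {G : Type*} [TopologicalSpace G] [ChartedSpace E G] [IsManifold 𝓘(ℝ, E) ∞ G]
    {M : Type*} [TopologicalSpace M] [ChartedSpace F M] [IsManifold 𝓘(ℝ, F) ∞ M]
    (𝒢 : LieGroupoid E F G M) {k : ℕ} (Θ : FormField 𝓘(ℝ, E) G k)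
    (hΘ : IsSmoothForm 𝓘(ℝ, E) Θ) :
    𝒢.IsAffine Θ ↔ IsIsotropicSubmanifold 𝒢.parallelograms (alternatingSum Θ) :=
  ⟨fun h => ⟨⟨_, 𝒢.isSubmanifold_parallelograms⟩, h.eqOnSubmanifold_parallelograms⟩,
    fun h => 𝒢.isAffine_of_eqOnSubmanifold_parallelograms h.2⟩
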